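/- A set in $\mathbb{R}^n$ is polyhedral if it is a finite intersection of closed half-spaces. A proper face of a polyhedral set $P$ is a nonempty subset $F \ne P$ that is the set of points of $P$ at which some linear functional attains its maximum over $P$. Let $f \colon \mathbb{R}^n \to \mathbb{R}^n$ be a piecewise affine mapping, that is, a continuous mapping for which there are triples $(\Omega_i, A_i, b_i)$, $i = 1, \ldots, k$, where each $\Omega_i \subset \mathbb{R}^n$ is a polyhedral set with nonempty interior, each $A_i$ is a real $n \times n$ matrix and each $b_i \in \mathbb{R}^n$, such that (a) $\mathbb{R}^n = \bigcup_{i=1}^k \Omega_i$; (b) for $i \neq j$, the set $\Omega_i \cap \Omega_j$ is either empty or a proper face of both $\Omega_i$ and $\Omega_j$; (c) $f(x) = A_i x + b_i$ for all $x \in \Omega_i$, $i = 1, \ldots, k$. Then, for every such choice of triples, $f$ is open (it maps open subsets of $\mathbb{R}^n$ to open subsets of $\mathbb{R}^n$) if and only if it is coherently oriented, that is, the determinants $\det A_1, \ldots, \det A_k$ are either all positive or all negative. -/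

import Mathlib

/-- A polyhedral set in `ℝⁿ`: a finite intersection of closed half-spaces. -/
def IsPolyhedralSet {n : ℕ} (P : Set (EuclideanSpace ℝ (Fin n))) : Prop :=
  ∃ (m : ℕ) (a : Fin m → EuclideanSpace ℝ (Fin n)) (c : Fin m → ℝ),
    P = {x | ∀ j, inner ℝ (a j) x ≤ c j}

/-- `F` is a proper face of `P`: it is nonempty, different from `P`, and it is the set of
points of `P` at which some linear functional attains its maximum over `P`. -/
def IsProperFace {n : ℕ} (P F : Set (EuclideanSpace ℝ (Fin n))) : Prop :=
  F.Nonempty ∧ IsExposed ℝ P F ∧ F ≠ P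

/-- The triples `(Ω i, A i, b i)`, `i = 1, …, k`, exhibit the continuous map `f : ℝⁿ → ℝⁿ` as a
piecewise affine map. -/
structure IsPiecewiseAffineWith {n k : ℕ}
    (f : EuclideanSpace ℝ (Fin n) → EuclideanSpace ℝ (Fin n))
    (Ω : Fin k → Set (EuclideanSpace ℝ (Fin n)))
    (A : Fin k → Matrix (Fin n) (Fin n) ℝ)
    (b : Fin k → EuclideanSpace ℝ (Fin n)) : Prop where
  continuous : Continuous f
  polyhedral : ∀ i, IsPolyhedralSet (Ω i)
  interior_nonempty : ∀ i, (interior (Ω i)).Nonempty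
  cover : ⋃ i, Ω i = Set.univ
  inter_face : ∀ i j, i ≠ j → Ω i ∩ Ω j = ∅ ∨
    (IsProperFace (Ω i) (Ω i ∩ Ω j) ∧ IsProperFace (Ω j) (Ω i ∩ Ω j))
  eq_affine : ∀ i, ∀ x ∈ Ω i, f x = WithLp.toLp 2 (Matrix.mulVec (A i) x.ofLp) + b i

/-- All the matrices have determinants of the same nonzero sign. -/
def IsCoherentlyOriented {n k : ℕ} (A : Fin k → Matrix (Fin n) (Fin n) ℝ) : Prop :=
  (∀ i, 0 < (A i).det) ∨ (∀ i, (A i).det < 0)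

/-! The hyperplanes bounding the pieces cross transversally only in codimension two. At any other
point at most two pieces meet, along one hyperplane, and there `f` is `h ↦ S (h + (g h)⁺ v)` up to
translations, with determinants `det S` and `det S * (1 + g v)` on the two sides. If `1 + g v > 0`,
this fold has a continuous local right inverse, so it is open at the point; if `1 + g v < 0`, it
sends a neighbourhood into a half-space bounded through the image point, so it is not.

Codimension two does not disconnect. If `f` is open, all determinants are nonzero, and if both signs
occurred, a segment of simple points between pieces of opposite sign would contain a non-open fold.
Conversely, under coherent orientation the images of non-simple points again lie in finitely many
subspaces of codimension two. If a small ball's image missed points near its centre's image, a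
segment avoiding these subspaces would leave the image through an interior point of it. -/

open Set Filter Topology

/-! ### Avoiding codimension two, and openness by connectedness -/

section Generic

variable {E : Type*} [NormedAddCommGroup E] [NormedSpace ℝ E]

/-- `x` lies on no two transversal hyperplanes of the family `{l s = c s}`. -/
def IsSimplePoint {ι : Type*} (l : ι → StrongDual ℝ E) (c : ι → ℝ) (x : E) : Prop :=
  ∀ s t, LinearIndependent ℝ ![l s, l t] → ¬ (l s x = c s ∧ l t x = c t)

theorem dense_setOf_ne {l : StrongDual ℝ E} (hl : l ≠ 0) (c : ℝ) : Dense {x | l x ≠ c} :=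
  (dense_compl_singleton c).preimage (l.isOpenMap_of_ne_zero hl)

theorem isOpen_setOf_ne (l : StrongDual ℝ E) (c : ℝ) : IsOpen {x | l x ≠ c} :=
  isOpen_ne_fun l.continuous continuous_const

/-- Between two nonempty open sets there is a segment that misses finitely many given affine
subspaces of codimension two. -/
theorem exists_segment_avoiding [CompleteSpace E] {ι : Type*} [Finite ι]
    (l₁ l₂ : ι → StrongDual ℝ E) (c₁ c₂ : ι → ℝ)
    (hl : ∀ i, LinearIndependent ℝ ![l₁ i, l₂ i]) {U W : Set E} (hU : IsOpen U)
    (hU' : U.Nonempty) (hW : IsOpen W) (hW' : W.Nonempty) :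
    ∃ z ∈ U, ∃ q ∈ W, ∀ w ∈ segment ℝ z q, ∀ i, ¬ (l₁ i w = c₁ i ∧ l₂ i w = c₂ i) := by
  have hl' : ∀ i, ∀ s t : ℝ, s • l₁ i + t • l₂ i = 0 → s = 0 ∧ t = 0 := fun i =>
    LinearIndependent.pair_iff.1 (hl i)
  have hne : ∀ i, l₁ i ≠ 0 := fun i h => by
    simpa using (hl' i 1 0 (by simp [h])).1
  obtain ⟨z, hzU, hz⟩ := (dense_iInter_of_isOpen (fun i => isOpen_setOf_ne (l₁ i) (c₁ i))
    (fun i => dense_setOf_ne (hne i) (c₁ i))).inter_open_nonempty U hU hU'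
  rw [mem_iInter] at hz
  -- The level set of `h i` through `z` is the hyperplane spanned by `z` and the `i`-th subspace;
  -- for `q` off it, the segment misses the subspace.
  let h : ι → StrongDual ℝ E := fun i => (l₂ i z - c₂ i) • l₁ i + (c₁ i - l₁ i z) • l₂ i
  have hh : ∀ i, h i ≠ 0 := by
    intro i h0
    have := (hl' i _ _ h0).2
    exact hz i (by linarith)
  obtain ⟨q, hqW, hq⟩ := (dense_iInter_of_isOpen (fun i => isOpen_setOf_ne (h i) (h i z))
    (fun i => dense_setOf_ne (hh i) (h i z))).inter_open_nonempty W hW hW'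
  rw [mem_iInter] at hq
  refine ⟨z, hzU, q, hqW, ?_⟩
  rintro w ⟨α, β, hα, hβ, hαβ, rfl⟩ i ⟨e₁, e₂⟩
  have hz' : l₁ i z ≠ c₁ i := hz i
  have hq' : (l₂ i z - c₂ i) * l₁ i q + (c₁ i - l₁ i z) * l₂ i q ≠
    (l₂ i z - c₂ i) * l₁ i z + (c₁ i - l₁ i z) * l₂ i z := by simpa [h] using hq i
  simp only [map_add, map_smul, smul_eq_mul] at e₁ e₂
  obtain rfl : α = 1 - β := by linarith
  rcases eq_or_ne β 0 with rfl | hβ0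
  · exact hz' (by linarith)
  · refine hq' (mul_left_cancel₀ hβ0 ?_)
    linear_combination (l₂ i z - c₂ i) * e₁ - (l₁ i z - c₁ i) * e₂

/-- Between two nonempty open sets there is a segment of simple points. -/
theorem exists_segment_isSimplePoint [CompleteSpace E] {ι : Type*} [Finite ι]
    (l : ι → StrongDual ℝ E) (c : ι → ℝ) {U W : Set E} (hU : IsOpen U)
    (hU' : U.Nonempty) (hW : IsOpen W) (hW' : W.Nonempty) :
    ∃ z ∈ U, ∃ q ∈ W, ∀ w ∈ segment ℝ z q, IsSimplePoint l c w := by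
  obtain ⟨z, hz, q, hq, hseg⟩ := exists_segment_avoiding
    (ι := {s : ι × ι // LinearIndependent ℝ ![l s.1, l s.2]})
    (fun s => l s.1.1) (fun s => l s.1.2) (fun s => c s.1.1) (fun s => c s.1.2) (fun s => s.2)
    hU hU' hW hW'
  exact ⟨z, hz, q, hq, fun w hw s t hst => hseg w hw ⟨(s, t), hst⟩⟩

/-- The normals of the hyperplanes through a simple point are parallel. -/
theorem IsSimplePoint.exists_normal [Nontrivial E] {ι : Type*} {l : ι → StrongDual ℝ E} {c : ι → ℝ}
    {x : E} (hx : IsSimplePoint l c x) :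
    ∃ g : StrongDual ℝ E, g ≠ 0 ∧ ∀ s, l s x = c s → ∃ t : ℝ, l s = t • g := by
  by_cases H : ∃ s, l s x = c s ∧ l s ≠ 0
  · obtain ⟨s, hs, h0⟩ := H
    refine ⟨l s, h0, fun t ht => ?_⟩
    by_contra! hc
    exact hx s t ((LinearIndependent.pair_iff' h0).2 fun a ha => hc a ha.symm) ⟨hs, ht⟩
  · push Not at H
    obtain ⟨g, hg⟩ := exists_ne (0 : StrongDual ℝ E)
    exact ⟨g, hg, fun s hs => ⟨0, by rw [H s hs, zero_smul]⟩⟩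

theorem exists_apply_eq_one {g : StrongDual ℝ E} (hg : g ≠ 0) : ∃ a, g a = 1 := by
  obtain ⟨a, ha⟩ : ∃ a, g a ≠ 0 := by
    by_contra! h
    exact hg (ContinuousLinearMap.ext h)
  exact ⟨(g a)⁻¹ • a, by simp [ha]⟩

theorem exists_apply_lt_of_mem_nhds {g : StrongDual ℝ E} (hg : g ≠ 0) {x : E} {N : Set E}
    (hN : N ∈ 𝓝 x) : ∃ y ∈ N, g y < g x := by
  obtain ⟨a, ha⟩ := exists_apply_eq_one hg
  have ht : Tendsto (fun t : ℝ => x - t • a) (𝓝[>] 0) (𝓝 x) := by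
    have : Continuous fun t : ℝ => x - t • a := by fun_prop
    simpa using (this.tendsto 0).mono_left nhdsWithin_le_nhds
  obtain ⟨t, htN, ht0⟩ := ((ht.eventually_mem hN).and self_mem_nhdsWithin).exists
  exact ⟨_, htN, by simpa [ha] using ht0⟩

/-- A linear functional attaining its maximum over a set at an interior point vanishes, hence
a proper face contains no interior point. -/
theorem IsExposed.disjoint_interior {P F : Set E} (h : IsExposed ℝ P F) (hne : F ≠ P) :
    Disjoint F (interior P) := by
  rw [Set.disjoint_left]
  intro y hyF hyP
  obtain ⟨l, hl⟩ := h ⟨y, hyF⟩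
  have hmax : IsLocalMax l y := by
    rw [hl] at hyF
    filter_upwards [mem_interior_iff_mem_nhds.1 hyP] with z hz using hyF.2 z hz
  have : l = 0 := hmax.hasFDerivAt_eq_zero l.hasFDerivAt
  exact hne (by rw [hl, this]; simp)

/-- A continuous map with finite fibres is open if it is open at the points of a dense set `Q` and
if the images of the remaining points can be avoided by segments. -/
theorem isOpenMap_of_segments [ProperSpace E] {f : E → E} (hf : Continuous f)
    (hfib : ∀ y, (f ⁻¹' {y}).Finite) {Q : E → Prop}
    (hdense : ∀ U : Set E, IsOpen U → U.Nonempty → ∃ x ∈ U, Q x)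
    (hloc : ∀ x, Q x → 𝓝 (f x) ≤ Filter.map f (𝓝 x))
    (hpath : ∀ U W : Set E, IsOpen U → U.Nonempty → IsOpen W → W.Nonempty →
      ∃ z ∈ U, ∃ q ∈ W, ∀ x, f x ∈ segment ℝ z q → Q x) : IsOpenMap f := by
  refine isOpenMap_iff_nhds_le.2 fun x₀ N hN => ?_
  -- a closed ball whose boundary sphere misses the fibre of `x₀`
  have hiso : ∀ᶠ x in 𝓝 x₀, x ≠ x₀ → f x ≠ f x₀ :=
    eventually_nhdsWithin_iff.1 <| by
      have hfin := (hfib (f x₀)).subset (sdiff_subset (t := {x₀}))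
      filter_upwards [mem_nhdsWithin_of_mem_nhds (hfin.isClosed.isOpen_compl.mem_nhds
        (show x₀ ∉ _ from fun h => h.2 rfl)), self_mem_nhdsWithin] with x h₁ h₂ h₃
      exact h₁ ⟨h₃, h₂⟩
  obtain ⟨r, hr, hball⟩ := Metric.nhds_basis_closedBall.mem_iff.1 (inter_mem hN hiso)
  have hsphere : f x₀ ∉ f '' Metric.sphere x₀ r := by
    rintro ⟨x, hx, hfx⟩
    exact (hball (Metric.sphere_subset_closedBall hx)).2 (Metric.ne_of_mem_sphere hx hr.ne') hfx
  obtain ⟨δ, hδ, hV⟩ := Metric.isOpen_iff.1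
    ((isCompact_sphere x₀ r).image hf).isClosed.isOpen_compl _ hsphere
  set V := Metric.ball (f x₀) δ
  set C := f '' Metric.closedBall x₀ r
  have hC : IsClosed C := ((isCompact_closedBall x₀ r).image hf).isClosed
  suffices hVC : V ⊆ C by
    refine mem_of_superset (Metric.ball_mem_nhds _ hδ) fun y hy => ?_
    obtain ⟨x, hx, rfl⟩ := hVC hy
    exact (hball hx).1
  by_contra hVC
  obtain ⟨y, hyV, hyC⟩ := not_subset.1 hVC
  have hCnhds : ∀ x ∈ Metric.ball x₀ r, Q x → C ∈ 𝓝 (f x) := fun x hx hs =>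
    hloc x hs (mem_of_superset (image_mem_map (Metric.isOpen_ball.mem_nhds hx))
      (image_mono Metric.ball_subset_closedBall))
  have hO : IsOpen (Metric.ball x₀ r ∩ f ⁻¹' V) :=
    Metric.isOpen_ball.inter (Metric.isOpen_ball.preimage hf)
  have hO' : (Metric.ball x₀ r ∩ f ⁻¹' V).Nonempty :=
    ⟨x₀, Metric.mem_ball_self hr, Metric.mem_ball_self hδ⟩
  obtain ⟨x₁, hx₁, hx₁s⟩ := hdense _ hO hO'
  have hU' : (interior C ∩ V).Nonempty :=
    ⟨f x₁, mem_interior_iff_mem_nhds.2 (hCnhds x₁ hx₁.1 hx₁s), hx₁.2⟩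
  -- join an interior point of `C` to a point outside, avoiding the image of the bad points
  obtain ⟨z, hz, q, hq, hseg⟩ := hpath _ _
    (isOpen_interior.inter Metric.isOpen_ball) hU'
    (Metric.isOpen_ball.inter hC.isOpen_compl) ⟨y, hyV, hyC⟩
  have hsegV : segment ℝ z q ⊆ V := (convex_ball _ _).segment_subset hz.2 hq.1
  have hsegC : segment ℝ z q ∩ C ⊆ interior C := by
    rintro w ⟨hw, x, hx, rfl⟩
    have hxr : x ∈ Metric.ball x₀ r := by
      refine lt_of_le_of_ne hx fun hxe => hV (hsegV hw) ⟨x, hxe, rfl⟩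
    exact mem_interior_iff_mem_nhds.2 (hCnhds x hxr (hseg x hw))
  obtain ⟨w, -, hw₁, hw₂⟩ := (convex_segment (𝕜 := ℝ) z q).isPreconnected _ _ isOpen_interior
    hC.isOpen_compl
    (fun w hw => (em (w ∈ C)).imp (fun h => hsegC ⟨hw, h⟩) id)
    ⟨z, left_mem_segment ℝ z q, hz.1⟩ ⟨q, right_mem_segment ℝ z q, hq.2⟩
  exact hw₂ (interior_subset hw₁)

end Generic

/-! ### Two pieces at a simple point and the fold -/

section Pieces

variable {E : Type*} [NormedAddCommGroup E] [NormedSpace ℝ E]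

/-- Near a simple point of the hyperplane arrangement, a finite polyhedral subdivision of the space
consists of the two sides of one hyperplane (whose pieces may coincide). -/
theorem IsSimplePoint.exists_two_pieces [Nontrivial E] {κ : Type*} [Finite κ] {m : κ → ℕ}
    {l : (Σ p, Fin (m p)) → StrongDual ℝ E} {c : (Σ p, Fin (m p)) → ℝ} {Ω : κ → Set E}
    (hΩ : ∀ p, Ω p = {x | ∀ j, l ⟨p, j⟩ x ≤ c ⟨p, j⟩}) (hcover : ⋃ p, Ω p = univ)
    (hclosure : ∀ p, Ω p ⊆ closure (interior (Ω p)))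
    (hdisj : ∀ p q, p ≠ q → Disjoint (interior (Ω p)) (Ω q)) {x : E} (hx : IsSimplePoint l c x) :
    ∃ g : StrongDual ℝ E, g ≠ 0 ∧ ∃ i j,
      (∀ᶠ y in 𝓝 x, (g y ≤ g x → y ∈ Ω i) ∧ (g x ≤ g y → y ∈ Ω j)) ∧
      ∀ p, x ∈ Ω p → p = i ∨ p = j := by
  obtain ⟨g, hg, hpar⟩ := hx.exists_normal
  have hN : ∀ᶠ y in 𝓝 x, ∀ s, (l s x < c s → l s y < c s) ∧ (c s < l s x → c s < l s y) := by
    refine eventually_all.2 fun s => ?_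
    have hc : ContinuousAt (l s) x := (l s).continuous.continuousAt
    refine Eventually.and ?_ ?_
    · by_cases h : l s x < c s
      · filter_upwards [hc.eventually (gt_mem_nhds h)] with y hy _ using hy
      · exact Eventually.of_forall fun y h' => absurd h' h
    · by_cases h : c s < l s x
      · filter_upwards [hc.eventually (lt_mem_nhds h)] with y hy _ using hy
      · exact Eventually.of_forall fun y h' => absurd h' h
  -- A piece containing one nearby point strictly on a side contains that whole side locally:
  -- inactive constraints keep their sign, and active ones are nonnegative multiples of `g'`.
  have key : ∀ g' : StrongDual ℝ E, (∀ s, l s x = c s → ∃ t : ℝ, l s = t • g') → g' ≠ 0 →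
      ∃ i, ∀ᶠ y in 𝓝 x, g' y ≤ g' x → y ∈ Ω i := by
    intro g' hpar' hg'
    obtain ⟨y, hy, hlt⟩ := exists_apply_lt_of_mem_nhds hg' hN
    obtain ⟨i, hi⟩ := mem_iUnion.1 (hcover ▸ mem_univ y)
    refine ⟨i, ?_⟩
    filter_upwards [hN] with z hz hle
    rw [hΩ] at hi ⊢
    intro j
    rcases lt_trichotomy (l ⟨i, j⟩ x) (c ⟨i, j⟩) with h | h | h
    · exact ((hz _).1 h).le
    · obtain ⟨t, ht⟩ := hpar' _ h
      have hij := hi j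
      rw [← h, ht] at hij ⊢
      simp only [FunLike.coe_smul, Pi.smul_apply, smul_eq_mul] at hij ⊢
      have : 0 ≤ t := by
        by_contra! hneg
        nlinarith
      nlinarith
    · exact absurd (hi j) (not_le.2 ((hy _).2 h))
  obtain ⟨i, hi⟩ := key g hpar hg
  obtain ⟨j, hj⟩ := key (-g) (fun s hs => by
    obtain ⟨t, ht⟩ := hpar s hs
    exact ⟨-t, by rw [ht, neg_smul_neg]⟩) (neg_ne_zero.2 hg)
  have hij : ∀ᶠ y in 𝓝 x, (g y ≤ g x → y ∈ Ω i) ∧ (g x ≤ g y → y ∈ Ω j) := by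
    filter_upwards [hi, hj] with y h₁ h₂
    exact ⟨h₁, fun h => h₂ (by simpa using h)⟩
  refine ⟨g, hg, i, j, hij, fun p hp => ?_⟩
  obtain ⟨y, hy, hyp⟩ := mem_closure_iff_nhds.1 (hclosure p hp) _ hij
  by_contra! hne
  rcases le_total (g y) (g x) with h | h
  · exact Set.disjoint_left.1 (hdisj p i hne.1) hyp (hy.1 h)
  · exact Set.disjoint_left.1 (hdisj p j hne.2) hyp (hy.2 h)

/-- A map which near `x` is affine on both sides of a hyperplane is, up to a translation and the
linear map `S` of one side, of the form `h ↦ h + (g h)⁺ v`. -/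
theorem exists_fold_form {f : E → E} {S T S' : E →L[ℝ] E} (hS : ∀ h, S (S' h) = h)
    {g : StrongDual ℝ E} (hg : g ≠ 0) {x b d : E}
    (hf : ∀ᶠ y in 𝓝 x, (g y ≤ g x → f y = S y + b) ∧ (g x ≤ g y → f y = T y + d)) :
    ∃ v : E, (∀ h, T h = S (h + g h • v)) ∧
      ∀ᶠ y in 𝓝 x, f y = f x + S (y - x + max (g (y - x)) 0 • v) := by
  obtain ⟨a, ha⟩ := exists_apply_eq_one hg
  have hx := hf.self_of_nhds
  have e₁ := hx.1 le_rfl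
  have e₂ := hx.2 le_rfl
  -- Both formulas hold on the common hyperplane.
  have hker : ∀ u, g u = 0 → S u = T u := by
    intro u hu
    have ht : Tendsto (fun t : ℝ => x + t • u) (𝓝[>] 0) (𝓝 x) := by
      have : Continuous fun t : ℝ => x + t • u := by fun_prop
      simpa using (this.tendsto 0).mono_left nhdsWithin_le_nhds
    obtain ⟨t, ht, ht0⟩ := ((ht.eventually hf).and self_mem_nhdsWithin).exists
    have h₁ := ht.1 (by simp [hu])
    have h₂ := ht.2 (by simp [hu])
    have h₃ : t • S u = t • T u := by
      have : S (x + t • u) + b = T (x + t • u) + d := by rw [← h₁, ← h₂]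
      have e : S x + b = T x + d := by rw [← e₁, ← e₂]
      simp only [map_add, map_smul] at this
      calc t • S u = (S x + t • S u + b) - (S x + b) := by abel
        _ = t • T u := by rw [this, e]; abel
    exact smul_right_injective E (ne_of_gt ht0) h₃
  have hT : ∀ h, T h = S (h + g h • (S' (T a) - a)) := by
    intro h
    have := hker (h - g h • a) (by simp [ha])
    simp only [map_add, map_sub, map_smul, hS] at this ⊢
    rw [sub_eq_sub_iff_add_eq_add] at this
    rw [smul_sub, ← add_sub_assoc, this, add_sub_cancel_right]
  refine ⟨S' (T a) - a, hT, ?_⟩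
  filter_upwards [hf] with y hy
  rcases le_total (g y) (g x) with h | h
  · rw [hy.1 h, e₁, max_eq_right (by simpa using h)]
    simp only [map_sub, zero_smul, add_zero]
    abel
  · rw [hy.2 h, e₂, max_eq_left (by simpa using h), ← hT]
    simp only [map_sub]
    abel

/-- The fold form is open at `x` if the two sides have the same orientation. -/
theorem nhds_le_map_of_fold_form {f : E → E} {S S' : E →L[ℝ] E} (hS : ∀ h, S (S' h) = h)
    {g : StrongDual ℝ E} {x v : E} (hv : 0 < 1 + g v)
    (hf : ∀ᶠ y in 𝓝 x, f y = f x + S (y - x + max (g (y - x)) 0 • v)) :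
    𝓝 (f x) ≤ map f (𝓝 x) := by
  -- If `u = h + (g h)⁺ v`, then `(g u)⁺ = (1 + g v) (g h)⁺`; solving for `h` gives this right
  -- inverse.
  let φ : E → E := fun w =>
    x + (S' (w - f x) - ((1 + g v)⁻¹ * max (g (S' (w - f x))) 0) • v)
  have hφ : Tendsto φ (𝓝 (f x)) (𝓝 x) := by
    have : Continuous φ := by fun_prop
    simpa [φ] using this.tendsto (f x)
  have hinv : ∀ᶠ w in 𝓝 (f x), f (φ w) = w := by
    filter_upwards [hφ.eventually hf] with w hw
    rw [hw]
    have hφw : φ w - x = S' (w - f x) -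
        ((1 + g v)⁻¹ * max (g (S' (w - f x))) 0) • v := add_sub_cancel_left _ _
    rw [hφw]
    set u := S' (w - f x)
    have hmax : max (g (u - ((1 + g v)⁻¹ * max (g u) 0) • v)) 0 = (1 + g v)⁻¹ * max (g u) 0 := by
      rw [map_sub, map_smul, smul_eq_mul]
      rcases le_total (g u) 0 with h | h
      · simp [h]
      · rw [max_eq_left h]
        have : g u - (1 + g v)⁻¹ * g u * g v = (1 + g v)⁻¹ * g u := by
          field_simp
          ring
        rw [this, max_eq_left (by positivity)]
    rw [hmax, sub_add_cancel, hS, add_sub_cancel]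
  calc 𝓝 (f x) = map (f ∘ φ) (𝓝 (f x)) := by
        rw [map_congr (show f ∘ φ =ᶠ[𝓝 (f x)] id from hinv), map_id]
    _ = map f (map φ (𝓝 (f x))) := map_map.symm
    _ ≤ map f (𝓝 x) := map_mono hφ

/-- The fold form is not open at `x` if the two sides have opposite orientations. -/
theorem not_nhds_le_map_of_fold_form {f : E → E} {S S' : E →L[ℝ] E} (hS : ∀ h, S' (S h) = h)
    {g : StrongDual ℝ E} (hg : g ≠ 0) {x v : E} (hv : 1 + g v < 0)
    (hf : ∀ᶠ y in 𝓝 x, f y = f x + S (y - x + max (g (y - x)) 0 • v)) :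
    ¬ 𝓝 (f x) ≤ map f (𝓝 x) := by
  intro hle
  -- With `h = y - x`, the increment of `g ∘ S'` is `g h` or `(1 + g v) * g h`, nonpositive on its
  -- side.
  have hle' : ∀ᶠ y in 𝓝 x, (g.comp S') (f x) ≥ (g.comp S') (f y) := by
    filter_upwards [hf] with y hy
    rw [hy]
    simp only [map_add, ContinuousLinearMap.comp_apply, hS, map_smul, smul_eq_mul]
    rcases le_total (g (y - x)) 0 with h | h
    · rw [max_eq_right h]
      linarith
    · rw [max_eq_left h]
      nlinarith
  have hne : -(g.comp S') ≠ 0 := by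
    obtain ⟨a, ha⟩ := exists_apply_eq_one hg
    intro h0
    have := DFunLike.congr_fun h0 (S a)
    simp [hS, ha] at this
  obtain ⟨w, hw, hlt⟩ := exists_apply_lt_of_mem_nhds hne
    (hle (show {w | (g.comp S') (f x) ≥ (g.comp S') w} ∈ map f (𝓝 x) from hle'))
  simp only [FunLike.coe_neg, Pi.neg_apply, neg_lt_neg_iff] at hlt
  exact absurd hw (not_le.2 hlt)

end Pieces

/-! ### Determinants and piecewise affine maps -/

section Euclidean

open Matrix

variable {n : ℕ}

/-- The factor `u ↦ u + g u • v` is a transvection, of determinant `1 + g v`. -/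
theorem det_eq_mul_one_add {A B : Matrix (Fin n) (Fin n) ℝ}
    {g : StrongDual ℝ (EuclideanSpace ℝ (Fin n))} {v : EuclideanSpace ℝ (Fin n)}
    (h : ∀ u, toEuclideanCLM (𝕜 := ℝ) B u = toEuclideanCLM (𝕜 := ℝ) A (u + g u • v)) :
    B.det = A.det * (1 + g v) := by
  have hdet : ∀ M : Matrix (Fin n) (Fin n) ℝ, LinearMap.det (toEuclideanLin M) = M.det :=
    fun M => by
    rw [toEuclideanLin_eq_toLin_orthonormal, LinearMap.det_toLin]
  have hcomp : toEuclideanLin B =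
      toEuclideanLin A ∘ₗ LinearMap.transvection (g : Module.Dual ℝ (EuclideanSpace ℝ (Fin n))) v :=
    LinearMap.ext h
  rw [← hdet, hcomp, LinearMap.det_comp, hdet, LinearMap.transvection.det]
  rfl

theorem toEuclideanCLM_mul_inv_apply {A : Matrix (Fin n) (Fin n) ℝ} (hA : A.det ≠ 0)
    (x : EuclideanSpace ℝ (Fin n)) :
    toEuclideanCLM (𝕜 := ℝ) A (toEuclideanCLM (𝕜 := ℝ) A⁻¹ x) = x := by
  rw [← mul_apply_eq_comp, ← map_mul, mul_nonsing_inv _ hA.isUnit, map_one]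
  rfl

theorem toEuclideanCLM_inv_mul_apply {A : Matrix (Fin n) (Fin n) ℝ} (hA : A.det ≠ 0)
    (x : EuclideanSpace ℝ (Fin n)) :
    toEuclideanCLM (𝕜 := ℝ) A⁻¹ (toEuclideanCLM (𝕜 := ℝ) A x) = x := by
  rw [← mul_apply_eq_comp, ← map_mul, nonsing_inv_mul _ hA.isUnit, map_one]
  rfl

theorem IsPolyhedralSet.isClosed {P : Set (EuclideanSpace ℝ (Fin n))} (hP : IsPolyhedralSet P)
    : IsClosed P := by
  obtain ⟨m, a, c, rfl⟩ := hP
  simp only [ofPred_forall]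
  exact isClosed_iInter fun j => isClosed_le (by fun_prop) continuous_const

theorem IsPolyhedralSet.convex {P : Set (EuclideanSpace ℝ (Fin n))} (hP : IsPolyhedralSet P)
    : Convex ℝ P := by
  obtain ⟨m, a, c, rfl⟩ := hP
  simp only [ofPred_forall]
  exact convex_iInter fun j => convex_halfSpace_le (innerSL ℝ (a j)).isLinear (c j)

namespace IsPiecewiseAffineWith

variable {k : ℕ} {f : EuclideanSpace ℝ (Fin n) → EuclideanSpace ℝ (Fin n)}
  {Ω : Fin k → Set (EuclideanSpace ℝ (Fin n))} {A : Fin k → Matrix (Fin n) (Fin n) ℝ}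
  {b : Fin k → EuclideanSpace ℝ (Fin n)}

theorem eq_toEuclideanCLM (hf : IsPiecewiseAffineWith f Ω A b) {i : Fin k}
    {x : EuclideanSpace ℝ (Fin n)} (hx : x ∈ Ω i) :
    f x = toEuclideanCLM (𝕜 := ℝ) (A i) x + b i :=
  hf.eq_affine i x hx

theorem exists_mem (hf : IsPiecewiseAffineWith f Ω A b) (x : EuclideanSpace ℝ (Fin n))
    : ∃ i, x ∈ Ω i :=
  mem_iUnion.1 (hf.cover ▸ mem_univ x)

theorem subset_closure_interior (hf : IsPiecewiseAffineWith f Ω A b) (i : Fin k) :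
    Ω i ⊆ closure (interior (Ω i)) := by
  rw [(hf.polyhedral i).convex.closure_interior_eq_closure_of_nonempty_interior
    (hf.interior_nonempty i)]
  exact subset_closure

theorem disjoint_interior (hf : IsPiecewiseAffineWith f Ω A b) (i j : Fin k) (hij : i ≠ j) :
    Disjoint (interior (Ω i)) (Ω j) := by
  rw [Set.disjoint_left]
  intro y hi hj
  rcases hf.inter_face i j hij with h | ⟨h, -⟩
  · exact
    (h ▸ (⟨interior_subset hi, hj⟩ : y ∈ Ω i ∩ Ω j) : y ∈ (∅ : Set (EuclideanSpace ℝ (Fin n))))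
  · exact Set.disjoint_left.1 (h.2.1.disjoint_interior h.2.2) ⟨interior_subset hi, hj⟩ hi

/-- The half-spaces defining the pieces, as one family of linear functionals. -/
theorem exists_constraints (hf : IsPiecewiseAffineWith f Ω A b) :
    ∃ (m : Fin k → ℕ) (l : (Σ p, Fin (m p)) → StrongDual ℝ (EuclideanSpace ℝ (Fin n)))
    (c : (Σ p, Fin (m p)) → ℝ),
      ∀ p, Ω p = {x | ∀ j, l ⟨p, j⟩ x ≤ c ⟨p, j⟩} := by
  choose m a c h using hf.polyhedral
  exact ⟨m, fun s => innerSL ℝ (a s.1 s.2), fun s => c s.1 s.2, h⟩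

/-- The local form of a piecewise affine map at a simple point. -/
theorem exists_fold (hf : IsPiecewiseAffineWith f Ω A b) (hn : n ≠ 0)
    (hdet : ∀ i, (A i).det ≠ 0) {m : Fin k → ℕ}
    {l : (Σ p, Fin (m p)) → StrongDual ℝ (EuclideanSpace ℝ (Fin n))}
    {c : (Σ p, Fin (m p)) → ℝ} (hΩ : ∀ p, Ω p = {x | ∀ j, l ⟨p, j⟩ x ≤ c ⟨p, j⟩})
    {x : EuclideanSpace ℝ (Fin n)}
    (hx : IsSimplePoint l c x) :
    ∃ (g : StrongDual ℝ (EuclideanSpace ℝ (Fin n))) (v : EuclideanSpace ℝ (Fin n))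
    (i j : Fin k), g ≠ 0 ∧
      (A j).det = (A i).det * (1 + g v) ∧
      (∀ᶠ y in 𝓝 x,
        f y = f x + toEuclideanCLM (𝕜 := ℝ) (A i) (y - x + max (g (y - x)) 0 • v)) ∧
      ∀ p, x ∈ Ω p → p = i ∨ p = j := by
  have : NeZero n := ⟨hn⟩
  obtain ⟨g, hg, i, j, hij, hp⟩ := hx.exists_two_pieces hΩ hf.cover hf.subset_closure_interior
    hf.disjoint_interior
  obtain ⟨v, hv, hfv⟩ := exists_fold_form (toEuclideanCLM_mul_inv_apply (hdet i)) hg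
    (hij.mono fun y hy => ⟨fun h => hf.eq_toEuclideanCLM (hy.1 h),
      fun h => hf.eq_toEuclideanCLM (hy.2 h)⟩)
  exact ⟨g, v, i, j, hg, det_eq_mul_one_add hv, hfv, hp⟩

/-- The image of a piece's interior is open and lies in a translate of the range of `A i`, so that
range is everything. -/
theorem det_ne_zero_of_isOpenMap (hf : IsPiecewiseAffineWith f Ω A b) (ho : IsOpenMap f)
    (i : Fin k) : (A i).det ≠ 0 := by
  have hV : IsOpen ((fun y => y - b i) '' (f '' interior (Ω i))) :=
    (Homeomorph.subRight (b i)).isOpenMap _ (ho _ isOpen_interior)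
  have hsub : (fun y => y - b i) '' (f '' interior (Ω i)) ⊆
      (LinearMap.range (toEuclideanLin (A i)) : Set (EuclideanSpace ℝ (Fin n))) := by
    rintro _ ⟨_, ⟨x, hx, rfl⟩, rfl⟩
    exact ⟨x, by simp only [hf.eq_toEuclideanCLM (interior_subset hx), add_sub_cancel_right]; rfl⟩
  have htop : LinearMap.range (toEuclideanLin (A i)) = ⊤ :=
    Submodule.eq_top_of_nonempty_interior' _
      ((((hf.interior_nonempty i).image _).image _).mono (interior_maximal hsub hV))
  have hunit : IsUnit (toEuclideanLin (A i)) :=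
    (LinearMap.isUnit_iff_range_eq_top _).2 htop
  have := hunit.map LinearMap.det
  rw [toEuclideanLin_eq_toLin_orthonormal, LinearMap.det_toLin] at this
  exact this.ne_zero

theorem isCoherentlyOriented_of_isOpenMap (hf : IsPiecewiseAffineWith f Ω A b) (hn : n ≠ 0)
    (ho : IsOpenMap f) : IsCoherentlyOriented A := by
  have hdet := hf.det_ne_zero_of_isOpenMap ho
  by_contra hcon
  simp only [IsCoherentlyOriented, not_or, not_forall, not_lt] at hcon
  obtain ⟨⟨i₁, h₁⟩, i₂, h₂⟩ := hcon
  obtain ⟨m, l, c, hΩ⟩ := hf.exists_constraints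
  obtain ⟨z, hz, q, hq, hseg⟩ := exists_segment_isSimplePoint l c
    isOpen_interior (hf.interior_nonempty i₁) isOpen_interior (hf.interior_nonempty i₂)
  have hclosed : ∀ Q : Fin k → Prop, IsClosed (⋃ i : {i // Q i}, Ω i) := fun Q =>
    isClosed_iUnion_of_finite fun i => (hf.polyhedral i).isClosed
  -- By connectedness, some point of the segment lies in pieces of both signs.
  obtain ⟨x, hxs, hx₁, hx₂⟩ := isPreconnected_closed_iff.1 (convex_segment z q).isPreconnected
    _ _ (hclosed fun i => (A i).det < 0) (hclosed fun i => 0 < (A i).det)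
    (fun y _ => by
      obtain ⟨i, hi⟩ := hf.exists_mem y
      rcases (hdet i).lt_or_gt with h | h
      · exact Or.inl (mem_iUnion.2 ⟨⟨i, h⟩, hi⟩)
      · exact Or.inr (mem_iUnion.2 ⟨⟨i, h⟩, hi⟩))
    ⟨z, left_mem_segment ℝ z q,
      mem_iUnion.2 ⟨⟨i₁, lt_of_le_of_ne h₁ (hdet i₁)⟩, interior_subset hz⟩⟩
    ⟨q, right_mem_segment ℝ z q,
      mem_iUnion.2 ⟨⟨i₂, lt_of_le_of_ne h₂ (hdet i₂).symm⟩, interior_subset hq⟩⟩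
  obtain ⟨⟨p₁, hp₁⟩, hxp₁⟩ := mem_iUnion.1 hx₁
  obtain ⟨⟨p₂, hp₂⟩, hxp₂⟩ := mem_iUnion.1 hx₂
  obtain ⟨g, v, i, j, hg, hij, hfold, hpieces⟩ := hf.exists_fold hn hdet hΩ (hseg x hxs)
  have hv : 1 + g v < 0 := by
    rcases hpieces p₁ hxp₁ with rfl | rfl <;> rcases hpieces p₂ hxp₂ with rfl | rfl
    · exact absurd hp₁ hp₂.not_gt
    · by_contra! h
      nlinarith
    · by_contra! h
      nlinarith
    · exact absurd hp₁ hp₂.not_gt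
  exact not_nhds_le_map_of_fold_form (toEuclideanCLM_inv_mul_apply (hdet i)) hg hv hfold
    (isOpenMap_iff_nhds_le.1 ho x)

theorem nhds_le_map_of_isSimplePoint (hf : IsPiecewiseAffineWith f Ω A b) (hn : n ≠ 0)
    (hA : IsCoherentlyOriented A) {m : Fin k → ℕ}
    {l : (Σ p, Fin (m p)) → StrongDual ℝ (EuclideanSpace ℝ (Fin n))}
    {c : (Σ p, Fin (m p)) → ℝ} (hΩ : ∀ p, Ω p = {x | ∀ j, l ⟨p, j⟩ x ≤ c ⟨p, j⟩})
    {x : EuclideanSpace ℝ (Fin n)}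
    (hx : IsSimplePoint l c x) : 𝓝 (f x) ≤ Filter.map f (𝓝 x) := by
  have hdet : ∀ i, (A i).det ≠ 0 := fun i => hA.elim (fun h => (h i).ne') (fun h => (h i).ne)
  obtain ⟨g, v, i, j, -, hij, hfold, -⟩ := hf.exists_fold hn hdet hΩ hx
  refine nhds_le_map_of_fold_form (toEuclideanCLM_mul_inv_apply (hdet i)) ?_ hfold
  rcases hA with h | h
  · exact pos_of_mul_pos_right (hij ▸ h j) (h i).le
  · exact pos_of_mul_neg_right (hij ▸ h j) (h i).le

theorem finite_fiber (hf : IsPiecewiseAffineWith f Ω A b) (hdet : ∀ i, (A i).det ≠ 0)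
    (y : EuclideanSpace ℝ (Fin n)) :
    (f ⁻¹' {y}).Finite := by
  refine (finite_range fun i => toEuclideanCLM (𝕜 := ℝ) (A i)⁻¹ (y - b i)).subset fun x hx => ?_
  obtain ⟨i, hi⟩ := hf.exists_mem x
  refine ⟨i, ?_⟩
  have hx' : f x = y := hx
  simp only [← hx', hf.eq_toEuclideanCLM hi, add_sub_cancel_right]
  exact toEuclideanCLM_inv_mul_apply (hdet i) x

/-- Between two nonempty open sets there is a segment such that all preimages of its points are
simple. -/
theorem exists_segment_preimage_isSimplePoint (hf : IsPiecewiseAffineWith f Ω A b)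
    (hdet : ∀ i, (A i).det ≠ 0) {ι : Type*} [Finite ι]
    (l : ι → StrongDual ℝ (EuclideanSpace ℝ (Fin n))) (c : ι → ℝ)
    {U W : Set (EuclideanSpace ℝ (Fin n))} (hU : IsOpen U) (hU' : U.Nonempty) (hW : IsOpen W)
    (hW' : W.Nonempty) :
    ∃ z ∈ U, ∃ q ∈ W, ∀ x, f x ∈ segment ℝ z q → IsSimplePoint l c x := by
  let R : Fin k → EuclideanSpace ℝ (Fin n) →L[ℝ] EuclideanSpace ℝ (Fin n) :=
    fun p => toEuclideanCLM (𝕜 := ℝ) (A p)⁻¹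
  have hR : ∀ p, Function.Surjective (R p) := fun p x =>
    ⟨_, toEuclideanCLM_inv_mul_apply (hdet p) x⟩
  -- On piece `p`, `R p (f x) = x + R p (b p)`; this turns `l s x = c s` into an affine equation for
  -- `f x`.
  obtain ⟨z, hz, q, hq, hseg⟩ := exists_segment_avoiding
    (ι := {s : ι × ι // LinearIndependent ℝ ![l s.1, l s.2]} × Fin k)
    (fun s => (l s.1.1.1).comp (R s.2)) (fun s => (l s.1.1.2).comp (R s.2))
    (fun s => c s.1.1.1 + l s.1.1.1 (R s.2 (b s.2)))
    (fun s => c s.1.1.2 + l s.1.1.2 (R s.2 (b s.2)))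
    (fun s => LinearIndependent.pair_iff.2 fun α β h =>
      LinearIndependent.pair_iff.1 s.1.2 α β <| ContinuousLinearMap.ext fun x => by
        obtain ⟨x, rfl⟩ := hR s.2 x
        exact DFunLike.congr_fun h x)
    hU hU' hW hW'
  refine ⟨z, hz, q, hq, fun x hw s t hst hxst => ?_⟩
  obtain ⟨p, hp⟩ := hf.exists_mem x
  have hRx : R p (f x) = x + R p (b p) := by
    rw [hf.eq_toEuclideanCLM hp, map_add]
    exact congrArg (· + R p (b p)) (toEuclideanCLM_inv_mul_apply (hdet p) x)
  refine hseg _ hw (⟨(s, t), hst⟩, p) ⟨?_, ?_⟩ <;>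
    simp only [ContinuousLinearMap.comp_apply, hRx, map_add, hxst.1, hxst.2]

theorem isOpenMap_of_isCoherentlyOriented (hf : IsPiecewiseAffineWith f Ω A b) (hn : n ≠ 0)
    (hA : IsCoherentlyOriented A) : IsOpenMap f := by
  have hdet : ∀ i, (A i).det ≠ 0 := fun i => hA.elim (fun h => (h i).ne') (fun h => (h i).ne)
  obtain ⟨m, l, c, hΩ⟩ := hf.exists_constraints
  refine isOpenMap_of_segments hf.continuous (hf.finite_fiber hdet) (Q := IsSimplePoint l c)
    (fun U hU hU' => ?_) (fun x => hf.nhds_le_map_of_isSimplePoint hn hA hΩ)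
    (fun U W => hf.exists_segment_preimage_isSimplePoint hdet l c)
  obtain ⟨x, hx, q, -, hseg⟩ := exists_segment_isSimplePoint l c hU hU' hU hU'
  exact ⟨x, hx, hseg x (left_mem_segment ℝ x q)⟩

end IsPiecewiseAffineWith

end Euclidean

theorem corollary3p1 {n k : ℕ}
    (f : EuclideanSpace ℝ (Fin n) → EuclideanSpace ℝ (Fin n))
    (Ω : Fin k → Set (EuclideanSpace ℝ (Fin n)))
    (A : Fin k → Matrix (Fin n) (Fin n) ℝ)
    (b : Fin k → EuclideanSpace ℝ (Fin n))
    (hf : IsPiecewiseAffineWith f Ω A b) :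
    IsOpenMap f ↔ IsCoherentlyOriented A := by
  rcases eq_or_ne n 0 with rfl | hn
  -- In dimension zero the empty determinant is 1, and there is no nonzero functional to cut with.
  · exact iff_of_true (fun _ _ => isOpen_discrete _) (Or.inl fun i => by simp)
  · exact ⟨hf.isCoherentlyOriented_of_isOpenMap hn, hf.isOpenMap_of_isCoherentlyOriented hn⟩
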